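/- Consider episodic Markov decision processes with $S$ states, $A$ actions, horizon $H$ and $n$ agents. Such an MDP $M$ consists of an initial distribution $\rho$, a transition function $P(\cdot\mid s,a)$ and reward functions $r_1,\dots,r_n$ with values in $[0,1]$. A policy $\pi=(\pi_1,\dots,\pi_H)$ is non-stationary and possibly randomized, its value for agent $i$ is $V^\pi(r_i)=\mathbb{E}_\pi\big[\sum_{h=1}^H r_i(s_h,a_h)\mid s_1\sim\rho\big]$, and its Nash social welfare is $\mathrm{NW}(\pi)=\prod_{i=1}^n V^\pi(r_i)$. A learning policy interacts with $M$ for $T$ episodes. It knows $\rho$ and $r_1,\dots,r_n$ but not $P$. In each episode $t$ it chooses, possibly at random, a policy $\pi_t$ on the basis of the trajectories of the previous episodes. Its regret is $\mathrm{Reg}_{\mathrm{NW}}(T)=\sum_{t=1}^T\big(\max_\pi \mathrm{NW}(\pi)-\mathrm{NW}(\pi_t)\big)$. There are universal constants $C,c_1,c_2>0$ such that the following holds for all integers $n\ge 1$, $S\ge 3$, $A\ge 2$, $H$ and $T$ with $T\ge SA$, $T\ge c_1\log H$ and $H\ge c_2\log S$. For every learning policy there is an MDP with $S$ states and $A$ actions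 on which $$\mathbb{E}\big[\mathrm{Reg}_{\mathrm{NW}}(T)\big]\;\ge\; C\,n\left(\frac H2\right)^n\sqrt{SAT}.$$ -/

import Mathlib

open MeasureTheory

universe u

/-- An episodic Markov decision process with state space `Fin S`, action space `Fin A` and one
reward function with values in `[0, 1]` for each of the `n` agents. -/
structure MDP (n S A : ℕ) where
  /-- the distribution `ρ` of the initial state -/
  init : stdSimplex ℝ (Fin S)
  /-- the transition probabilities: `(trans s a).1 s'` is `P(s' | s, a)` -/
  trans : Fin S → Fin A → stdSimplex ℝ (Fin S)
  /-- the reward functions: `reward i s a` is `r_i(s, a)` -/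
  reward : Fin n → Fin S → Fin A → ℝ
  reward_mem : ∀ i s a, reward i s a ∈ Set.Icc (0 : ℝ) 1

/-- A non-stationary (randomized) policy `(π_1, …, π_H)`: at step `h` in state `s` it plays
action `a` with probability `(π h s).1 a`. -/
abbrev Policy (S A H : ℕ) : Type := Fin H → Fin S → stdSimplex ℝ (Fin A)

/-- A trajectory `(s_1, a_1, …, s_H, a_H)` of one episode. -/
abbrev Trajectory (S A H : ℕ) : Type := Fin H → Fin S × Fin A

namespace MDP

variable {n S A : ℕ} (M : MDP n S A) {H : ℕ}

/-- The probability of arriving in the state that the trajectory `τ` visits at step `h`, given the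
earlier part of `τ`. (Steps are counted from `0`.) -/
noncomputable def arrivalProb (τ : Trajectory S A H) (h : Fin H) : ℝ :=
  if h.val = 0 then M.init.1 (τ h).1
  else
    let prev : Fin H := ⟨h.val - 1, lt_of_le_of_lt (Nat.sub_le _ _) h.isLt⟩
    (M.trans (τ prev).1 (τ prev).2).1 (τ h).1

/-- The probability that an episode in which the policy `π` is played follows the trajectory
`τ`. -/
noncomputable def trajProb (π : Policy S A H) (τ : Trajectory S A H) : ℝ :=
  ∏ h : Fin H, M.arrivalProb τ h * (π h (τ h).1).1 (τ h).2

/-- The value `V^π(ρ; r_i)` of the policy `π` for agent `i`: the expectation of the sum of the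
rewards of agent `i` over the `H` steps of an episode. -/
noncomputable def value (π : Policy S A H) (i : Fin n) : ℝ :=
  ∑ τ : Trajectory S A H, M.trajProb π τ * ∑ h : Fin H, M.reward i (τ h).1 (τ h).2

/-- The Nash social welfare of a policy: the product of its values for the `n` agents. -/
noncomputable def nashWelfare (π : Policy S A H) : ℝ :=
  ∏ i : Fin n, M.value π i

/-- The largest Nash social welfare of a policy. -/
noncomputable def optNashWelfare (H : ℕ) : ℝ :=
  ⨆ π : Policy S A H, M.nashWelfare π

end MDP

/-- A learning policy. It has an internal source of randomness (a seed `ω`, drawn once from an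
arbitrary probability space), it knows the reward functions and the initial distribution, and it
chooses the policy that is played in the next episode on the basis of these and of the trajectories
of all the past episodes. It does not know the transition probabilities. -/
structure Learner (n S A H : ℕ) where
  /-- the space of the random seed -/
  Seed : Type u
  [measurableSpace : MeasurableSpace Seed]
  /-- the distribution of the random seed -/
  seedLaw : Measure Seed
  [isProbabilityMeasure : IsProbabilityMeasure seedLaw]
  /-- `play r ρ t past ω` is the policy played after the `t` past episodes `past`, when the reward
  functions are `r`, the initial distribution is `ρ` and the seed is `ω`. -/
  play : (Fin n → Fin S → Fin A → ℝ) → stdSimplex ℝ (Fin S) →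
    (t : ℕ) → (Fin t → Trajectory S A H) → Seed → Policy S A H
  measurable_play : ∀ r ρ t past, Measurable (play r ρ t past)

attribute [instance] Learner.measurableSpace Learner.isProbabilityMeasure

namespace Learner

variable {n S A H : ℕ} (L : Learner.{u} n S A H) (M : MDP n S A) {T : ℕ}

/-- The policy `π_t` that the learner with seed `ω` plays in episode `t` of the run `ξ` of `T`
episodes. It depends on the earlier episodes of `ξ` only. -/
noncomputable def policyAt (ω : L.Seed) (ξ : Fin T → Trajectory S A H) (t : Fin T) :
    Policy S A H :=
  L.play M.reward M.init t.val (fun u => ξ (Fin.castLE t.isLt.le u)) ω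

/-- The probability, given the seed `ω`, that the interaction of the learner with the MDP over `T`
episodes is the run `ξ`. -/
noncomputable def runProb (ω : L.Seed) (ξ : Fin T → Trajectory S A H) : ℝ :=
  ∏ t : Fin T, M.trajProb (L.policyAt M ω ξ t) (ξ t)

/-- The Nash welfare regret of the learner with seed `ω` in the run `ξ`. -/
noncomputable def nashRegret (ω : L.Seed) (ξ : Fin T → Trajectory S A H) : ℝ :=
  ∑ t : Fin T, (M.optNashWelfare H - M.nashWelfare (L.policyAt M ω ξ t))

/-- The expected Nash welfare regret over `T` episodes. -/
noncomputable def expectedNashRegret (T : ℕ) : ℝ :=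
  ∫ ω, ∑ ξ : Fin T → Trajectory S A H, L.runProb M ω ξ * L.nashRegret M ω ξ ∂L.seedLaw

end Learner

/-! The regret is averaged over a family of bandit-like MDPs. An episode starts in one of `S - 2`
equally likely contexts, and the first action leads to an absorbing state: the good one with
probability `1/2`, or `1/2 + ε` if the action is the secret `θ s`. All agents share one reward, so
the Nash welfare is the `n`-th power of a common value, which is at least `H / 2`. Missing the
secret action with probability `m` lowers that value by `(H - 1) ε m`, hence the welfare by at least
`n (H/2)^n ε m` (`mul_pow_mul_le_pow_sub_pow`, `hardMDP_gap`).

To bound `m` from below, fix a context `s` and compare with the MDP in which `s` has no secret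
action. The two laws of an episode differ only when `a` is played in `s`, so the relative entropy is
at most `4 ε ^ 2` times the expected number of such plays (`sum_seqProb_mul_log_prod`,
`sum_trajProb_mul_log_likelihoodRatio`). A Pinsker bound (`sum_mul_density_le`) turns this into a
bound on the change of the hitting probability. In the comparison MDP the plays of all actions share
the visits to `s`, so when `ε ^ 2 * T` is a small multiple of `(S - 2) * A` a typical action cannot
be detected, and `m` is at least `1/4` on average (`card_div_four_le_sum_update`). Averaging over
`θ` and the seed, with `ε` of order `√(SA/T)`, gives the bound. -/

/-! ### Sequential laws: marginals, entropy chain rule, change of measure. -/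

section SequentialLaw

variable {Ω : Type*}

/-- The probability of the sequence `ξ` when `q t past` is the law of the entry number `t`, given
the earlier entries `past`. -/
noncomputable def seqProb (q : (t : ℕ) → (Fin t → Ω) → Ω → ℝ) (N : ℕ) (ξ : Fin N → Ω) : ℝ :=
  ∏ t : Fin N, q t (fun u => ξ (Fin.castLE t.isLt.le u)) (ξ t)

lemma seqProb_snoc (q : (t : ℕ) → (Fin t → Ω) → Ω → ℝ) (N : ℕ) (ξ : Fin N → Ω) (x : Ω) :
    seqProb q (N + 1) (Fin.snoc ξ x : Fin (N + 1) → Ω) = seqProb q N ξ * q N ξ x := by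
  unfold seqProb
  rw [Fin.prod_univ_castSucc]
  have h : ∀ u : Fin N, (Fin.snoc ξ x : Fin (N + 1) → Ω) u.castSucc = ξ u := fun u =>
    Fin.snoc_castSucc (α := fun _ => Ω) x ξ u
  congr 1
  · refine Finset.prod_congr rfl fun t _ => ?_
    have h2 : (fun u : Fin t.castSucc.val =>
        (Fin.snoc ξ x : Fin (N + 1) → Ω) (Fin.castLE t.castSucc.isLt.le u)) =
        fun u => ξ (Fin.castLE t.isLt.le u) :=
      funext fun u => h (Fin.castLE t.isLt.le u)
    rw [h2, h]
    rfl
  · have h2 : (fun u : Fin (Fin.last N).val =>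
        (Fin.snoc ξ x : Fin (N + 1) → Ω) (Fin.castLE (Fin.last N).isLt.le u)) = ξ :=
      funext fun u => h u
    rw [h2, Fin.snoc_last]
    rfl

lemma sum_fin_succ_fun_eq_sum_snoc [Fintype Ω] (N : ℕ) (F : (Fin (N + 1) → Ω) → ℝ) :
    ∑ ξ, F ξ = ∑ ξ : Fin N → Ω, ∑ x, F (Fin.snoc ξ x : Fin (N + 1) → Ω) := by
  rw [← (Fin.snocEquiv (fun _ : Fin (N + 1) => Ω)).sum_comp F, Fintype.sum_prod_type_right]
  rfl

/-- Entries after time `t` integrate out one at a time, because each kernel has total mass one. -/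
lemma sum_seqProb_castLE [Fintype Ω] {q : (t : ℕ) → (Fin t → Ω) → Ω → ℝ}
    (hq : ∀ t past, ∑ x, q t past x = 1) {t N : ℕ} (h : t ≤ N) (g : (Fin t → Ω) → ℝ) :
    ∑ ξ : Fin N → Ω, seqProb q N ξ * g (fun u => ξ (Fin.castLE h u)) =
      ∑ ξ : Fin t → Ω, seqProb q t ξ * g ξ := by
  induction N, h using Nat.le_induction with
  | base => rfl
  | succ N h ih =>
    rw [sum_fin_succ_fun_eq_sum_snoc, ← ih]
    refine Finset.sum_congr rfl fun ξ _ => ?_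
    have h2 : ∀ x : Ω, (fun u : Fin t => (Fin.snoc ξ x : Fin (N + 1) → Ω)
        (Fin.castLE (h.trans N.le_succ) u)) = fun u => ξ (Fin.castLE h u) := fun x =>
      funext fun u => Fin.snoc_castSucc (α := fun _ => Ω) x ξ (Fin.castLE h u)
    simp_rw [h2, seqProb_snoc]
    rw [← Finset.sum_mul, ← Finset.mul_sum, hq, mul_one]

lemma sum_seqProb [Fintype Ω] {q : (t : ℕ) → (Fin t → Ω) → Ω → ℝ}
    (hq : ∀ t past, ∑ x, q t past x = 1) (N : ℕ) : ∑ ξ : Fin N → Ω, seqProb q N ξ = 1 := by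
  have h := sum_seqProb_castLE hq (Nat.zero_le N) (fun _ => 1)
  simpa [seqProb] using h

lemma seqProb_nonneg {q : (t : ℕ) → (Fin t → Ω) → Ω → ℝ} (hq : ∀ t past x, 0 ≤ q t past x)
    (N : ℕ) (ξ : Fin N → Ω) : 0 ≤ seqProb q N ξ :=
  Finset.prod_nonneg fun _ _ => hq _ _ _

/-- The relative entropy of a reweighted sequential law adds up over time. -/
lemma sum_seqProb_mul_log_prod [Fintype Ω] {q : (t : ℕ) → (Fin t → Ω) → Ω → ℝ}
    (hq : ∀ t past, ∑ x, q t past x = 1) {w : Ω → ℝ} (hw : ∀ x, 0 < w x) (N : ℕ) :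
    ∑ ξ : Fin N → Ω, seqProb q N ξ * Real.log (∏ t, w (ξ t)) =
      ∑ t ∈ Finset.range N, ∑ past : Fin t → Ω,
        seqProb q t past * ∑ x, q t past x * Real.log (w x) := by
  induction N with
  | zero => simp
  | succ N ih =>
    rw [Finset.sum_range_succ, ← ih, sum_fin_succ_fun_eq_sum_snoc, ← Finset.sum_add_distrib]
    refine Finset.sum_congr rfl fun ξ _ => ?_
    have h : ∀ x : Ω, Real.log (∏ t, w ((Fin.snoc ξ x : Fin (N + 1) → Ω) t)) =
        Real.log (∏ t, w (ξ t)) + Real.log (w x) := fun x => by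
      rw [Fin.prod_univ_castSucc, Real.log_mul (Finset.prod_pos fun _ _ => hw _).ne' (hw _).ne']
      simp
    simp_rw [h, seqProb_snoc]
    calc ∑ x, seqProb q N ξ * q N ξ x * (Real.log (∏ t, w (ξ t)) + Real.log (w x))
        = seqProb q N ξ * Real.log (∏ t, w (ξ t)) * ∑ x, q N ξ x +
          seqProb q N ξ * ∑ x, q N ξ x * Real.log (w x) := by
          rw [Finset.mul_sum, Finset.mul_sum, ← Finset.sum_add_distrib]
          exact Finset.sum_congr rfl fun x _ => by ring
      _ = _ := by rw [hq, mul_one]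

/-- A form of Pinsker's inequality: reweighting by a density `L` changes the mean of a function
with values in `[0, 1]` by at most twice the square root of the relative entropy. -/
lemma sum_mul_density_le {ι : Type*} [Fintype ι] {p L X : ι → ℝ} (hp : ∀ i, 0 ≤ p i)
    (hp1 : ∑ i, p i = 1) (hL : ∀ i, 0 < L i) (hL1 : ∑ i, p i * L i = 1)
    (hX : ∀ i, X i ∈ Set.Icc (0 : ℝ) 1) :
    ∑ i, p i * L i * X i ≤ ∑ i, p i * X i + 2 * √(-∑ i, p i * Real.log (L i)) := by
  -- The argument goes through the Hellinger distance: `|L - 1| = |r - 1| * (r + 1)`, so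
  -- Cauchy–Schwarz applies, while `log r ≤ r - 1` bounds `∑ p (r - 1)^2` by the relative entropy,
  -- and `∑ p (r + 1)^2 ≤ 4`.
  set r : ι → ℝ := fun i => √(L i)
  have hr : ∀ i, 0 < r i := fun i => Real.sqrt_pos.2 (hL i)
  have hrL : ∀ i, r i ^ 2 = L i := fun i => Real.sq_sqrt (hL i).le
  have hlog : ∑ i, p i * Real.log (L i) ≤ 2 * (∑ i, p i * r i) - 2 := by
    have h : ∀ i, p i * Real.log (L i) ≤ 2 * (p i * r i) - 2 * p i := fun i => by
      have h1 := Real.log_le_sub_one_of_pos (hr i)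
      rw [← hrL i, Real.log_pow]
      push_cast
      nlinarith [hp i]
    calc _ ≤ ∑ i, (2 * (p i * r i) - 2 * p i) := Finset.sum_le_sum fun i _ => h i
      _ = _ := by rw [Finset.sum_sub_distrib, ← Finset.mul_sum, ← Finset.mul_sum, hp1]; ring
  have hminus : ∑ i, p i * (r i - 1) ^ 2 = 2 - 2 * ∑ i, p i * r i := by
    have h : ∀ i, p i * (r i - 1) ^ 2 = p i * L i - 2 * (p i * r i) + p i := fun i => by
      rw [← hrL i]; ring
    simp_rw [h]
    rw [Finset.sum_add_distrib, Finset.sum_sub_distrib, ← Finset.mul_sum, hp1, hL1]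
    ring
  have hplus : ∑ i, p i * (r i + 1) ^ 2 = 2 + 2 * ∑ i, p i * r i := by
    have h : ∀ i, p i * (r i + 1) ^ 2 = p i * L i + 2 * (p i * r i) + p i := fun i => by
      rw [← hrL i]; ring
    simp_rw [h]
    rw [Finset.sum_add_distrib, Finset.sum_add_distrib, ← Finset.mul_sum, hp1, hL1]
    ring
  have hminus0 : 0 ≤ ∑ i, p i * (r i - 1) ^ 2 :=
    Finset.sum_nonneg fun i _ => mul_nonneg (hp i) (sq_nonneg _)
  have hcs : (∑ i, p i * |L i - 1|) ^ 2 ≤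
      (∑ i, p i * (r i - 1) ^ 2) * ∑ i, p i * (r i + 1) ^ 2 := by
    refine Finset.sum_sq_le_sum_mul_sum_of_sq_le_mul _
      (fun i _ => mul_nonneg (hp i) (sq_nonneg _)) (fun i _ => mul_nonneg (hp i) (sq_nonneg _))
      fun i _ => ?_
    rw [mul_pow, sq_abs, ← hrL i]
    exact le_of_eq (by ring)
  have habs : ∑ i, p i * |L i - 1| ≤ 2 * √(-∑ i, p i * Real.log (L i)) := by
    refine abs_le_of_sq_le_sq' ?_ (by positivity) |>.2
    rw [mul_pow, Real.sq_sqrt (by linarith)]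
    nlinarith
  have hX' : ∑ i, p i * L i * X i - ∑ i, p i * X i ≤ ∑ i, p i * |L i - 1| := by
    rw [← Finset.sum_sub_distrib]
    refine Finset.sum_le_sum fun i _ => ?_
    have h1 : (L i - 1) * X i ≤ |L i - 1| := by
      nlinarith [(hX i).1, (hX i).2, mul_nonneg (abs_nonneg (L i - 1)) (sub_nonneg.2 (hX i).2),
        mul_nonneg (sub_nonneg.2 (le_abs_self (L i - 1))) (hX i).1]
    nlinarith [hp i, mul_le_mul_of_nonneg_left h1 (hp i)]
  linarith

/-- The change of the mean of `X` when the kernels of a sequential law are reweighted by `w`. -/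
lemma sum_seqProb_reweight_le [Fintype Ω] {q q' : (t : ℕ) → (Fin t → Ω) → Ω → ℝ}
    (hq0 : ∀ t past x, 0 ≤ q t past x) (hq : ∀ t past, ∑ x, q t past x = 1)
    (hq' : ∀ t past, ∑ x, q' t past x = 1) {w : Ω → ℝ} (hw : ∀ x, 0 < w x)
    (hqw : ∀ t past x, q' t past x = q t past x * w x) (N : ℕ) {X : (Fin N → Ω) → ℝ}
    (hX : ∀ ξ, X ξ ∈ Set.Icc (0 : ℝ) 1) :
    ∑ ξ, seqProb q' N ξ * X ξ ≤ ∑ ξ, seqProb q N ξ * X ξ +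
      2 * √(-∑ t ∈ Finset.range N, ∑ past : Fin t → Ω,
        seqProb q t past * ∑ x, q t past x * Real.log (w x)) := by
  have h : ∀ ξ, seqProb q' N ξ = seqProb q N ξ * ∏ t, w (ξ t) := fun ξ => by
    simp only [seqProb, hqw, Finset.prod_mul_distrib]
  rw [← sum_seqProb_mul_log_prod hq hw]
  simp_rw [h]
  refine sum_mul_density_le (fun ξ => seqProb_nonneg hq0 N ξ) (sum_seqProb hq N)
    (fun ξ => Finset.prod_pos fun _ _ => hw _) ?_ hX
  simp_rw [← h]
  exact sum_seqProb hq' N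

end SequentialLaw

/-! ### Two elementary tools: resampling a coordinate, differences of powers. -/

/-- Averaging over all functions is the same as resampling one value first. -/
lemma sum_sum_update {ι α : Type*} [Fintype ι] [DecidableEq ι] [Fintype α] (i : ι)
    (F : (ι → α) → ℝ) :
    ∑ θ : ι → α, ∑ a, F (Function.update θ i a) = Fintype.card α * ∑ θ, F θ := by
  -- Exchanging the value at `i` with the fresh one permutes the pairs `(θ, a)`.
  have hinv : Function.Involutive
      (fun x : (ι → α) × α => (Function.update x.1 i x.2, x.1 i)) := fun x => by simp
  have h := Equiv.sum_comp (Function.Involutive.toPerm _ hinv) (fun x : (ι → α) × α => F x.1)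
  rw [Fintype.sum_prod_type, Fintype.sum_prod_type] at h
  simp only [Function.Involutive.coe_toPerm, Finset.sum_const, nsmul_eq_mul, Finset.card_univ,
    ← Finset.mul_sum] at h
  exact h

/-- A mean value bound with derivative at least `n * z ^ (n - 1)`. The increment is measured in
units of `z`, which restores the full power `z ^ n` and avoids the exponent `n - 1`. -/
lemma mul_pow_mul_le_pow_sub_pow {x y z c : ℝ} (hz : 0 ≤ z) (hzy : z ≤ y) (hc : 0 ≤ c)
    (hx : z * c ≤ x - y) (n : ℕ) : n * z ^ n * c ≤ x ^ n - y ^ n := by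
  have hzx : z ≤ x := by nlinarith
  induction n with
  | zero => simp
  | succ n ih =>
    have h1 : z ^ n * (z * c) ≤ y ^ n * (x - y) :=
      mul_le_mul (pow_le_pow_left₀ hz hzy n) hx (by positivity) (pow_nonneg (hz.trans hzy) n)
    have h2 : z * (n * z ^ n * c) ≤ x * (x ^ n - y ^ n) :=
      mul_le_mul hzx ih (by positivity) (hz.trans hzx)
    push_cast
    linear_combination h1 + h2

/-! ### One episode as a sequential law. -/

namespace MDP

variable {n S A : ℕ} (M : MDP n S A) {l : ℕ}

/-- The law of step `t` of an episode, given the earlier steps. -/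
noncomputable def stepProb (π : Policy S A (l + 1)) (t : ℕ) (past : Fin t → Fin S × Fin A)
    (x : Fin S × Fin A) : ℝ :=
  (if h : t = 0 then M.init.1 x.1
    else (M.trans (past ⟨t - 1, by omega⟩).1 (past ⟨t - 1, by omega⟩).2).1 x.1) *
  -- The truncation `min t l` only gives meaning to times beyond the horizon; it is the identity for
  -- the steps of an episode.
  (π ⟨min t l, by omega⟩ x.1).1 x.2

lemma trajProb_eq_seqProb (π : Policy S A (l + 1)) (τ : Trajectory S A (l + 1)) :
    M.trajProb π τ = seqProb (M.stepProb π) (l + 1) τ := by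
  unfold trajProb seqProb
  refine Finset.prod_congr rfl fun h _ => ?_
  have hl : (⟨min h.val l, by omega⟩ : Fin (l + 1)) = h := Fin.ext (by simp; omega)
  unfold stepProb arrivalProb
  rw [hl]
  congr 1

lemma stepProb_nonneg (π : Policy S A (l + 1)) (t : ℕ) (past : Fin t → Fin S × Fin A)
    (x : Fin S × Fin A) : 0 ≤ M.stepProb π t past x := by
  unfold stepProb
  refine mul_nonneg ?_ ((π _ _).2.1 _)
  split_ifs
  · exact M.init.2.1 _
  · exact (M.trans _ _).2.1 _

lemma sum_stepProb (π : Policy S A (l + 1)) (t : ℕ) (past : Fin t → Fin S × Fin A) :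
    ∑ x, M.stepProb π t past x = 1 := by
  unfold stepProb
  rw [Fintype.sum_prod_type]
  simp_rw [← Finset.mul_sum, (π _ _).2.2, mul_one]
  split_ifs
  · exact M.init.2.2
  · exact (M.trans _ _).2.2

lemma trajProb_nonneg (π : Policy S A (l + 1)) (τ : Trajectory S A (l + 1)) :
    0 ≤ M.trajProb π τ :=
  M.trajProb_eq_seqProb π τ ▸ seqProb_nonneg (M.stepProb_nonneg π) _ _

lemma sum_trajProb (π : Policy S A (l + 1)) : ∑ τ, M.trajProb π τ = 1 := by
  simp_rw [trajProb_eq_seqProb]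
  exact sum_seqProb (M.sum_stepProb π) _

/-- The expectation of a function of the first transition. -/
lemma sum_trajProb_mul (π : Policy S A (l + 2)) (f : Fin S → Fin A → Fin S → ℝ) :
    ∑ τ, M.trajProb π τ * f (τ 0).1 (τ 0).2 (τ 1).1 =
      ∑ s, M.init.1 s * ∑ a, (π 0 s).1 a * ∑ s', (M.trans s a).1 s' * f s a s' := by
  simp_rw [trajProb_eq_seqProb]
  have h := sum_seqProb_castLE (M.sum_stepProb π) (show 2 ≤ l + 1 + 1 by omega)
    (fun σ : Fin 2 → Fin S × Fin A => f (σ 0).1 (σ 0).2 (σ 1).1)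
  have h0 : (Fin.castLE (show 2 ≤ l + 1 + 1 by omega) 0) = 0 := rfl
  have h1 : (Fin.castLE (show 2 ≤ l + 1 + 1 by omega) 1) = 1 := rfl
  simp only [h0, h1] at h
  rw [h, ← (finTwoArrowEquiv (Fin S × Fin A)).symm.sum_comp, Fintype.sum_prod_type,
    Fintype.sum_prod_type]
  refine Finset.sum_congr rfl fun s _ => ?_
  rw [Finset.mul_sum]
  refine Finset.sum_congr rfl fun a _ => ?_
  rw [Fintype.sum_prod_type, Finset.mul_sum, Finset.mul_sum]
  refine Finset.sum_congr rfl fun s' _ => ?_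
  have h2 : ∀ a', seqProb (M.stepProb π) 2 ((finTwoArrowEquiv (Fin S × Fin A)).symm
      ((s, a), (s', a'))) = M.init.1 s * (π 0 s).1 a * (M.trans s a).1 s' *
        (π ⟨min 1 (l + 1), by omega⟩ s').1 a' := fun a' => by
    simp only [seqProb, Fin.prod_univ_two, stepProb, finTwoArrowEquiv]
    simp [mul_assoc]
  simp_rw [h2]
  change ∑ a', _ * f s a s' = _
  rw [← Finset.sum_mul, ← Finset.mul_sum, (π _ _).2.2]
  ring

lemma trajProb_succ (π : Policy S A (l + 1)) (τ : Trajectory S A (l + 1)) :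
    M.trajProb π τ = (M.init.1 (τ 0).1 * (π 0 (τ 0).1).1 (τ 0).2) *
      ∏ h : Fin l, (M.trans (τ h.castSucc).1 (τ h.castSucc).2).1 (τ h.succ).1 *
        (π h.succ (τ h.succ).1).1 (τ h.succ).2 := by
  unfold trajProb
  rw [Fin.prod_univ_succ]
  rfl

lemma measurable_trajProb {α : Type*} [MeasurableSpace α] {H : ℕ} {π : α → Policy S A H}
    (hπ : Measurable π) (τ : Trajectory S A H) : Measurable fun x => M.trajProb (π x) τ := by
  unfold trajProb
  refine Finset.measurable_prod _ fun h _ => Measurable.const_mul ?_ _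
  have h1 : Measurable fun x => π x h (τ h).1 :=
    (measurable_pi_apply _).comp ((measurable_pi_apply _).comp hπ)
  exact (measurable_pi_apply _).comp (measurable_subtype_coe.comp h1)

lemma measurable_nashWelfare {α : Type*} [MeasurableSpace α] {H : ℕ} {π : α → Policy S A H}
    (hπ : Measurable π) : Measurable fun x => M.nashWelfare (π x) := by
  unfold nashWelfare value
  exact Finset.measurable_prod _ fun i _ => Finset.measurable_sum _ fun τ _ =>
    (M.measurable_trajProb hπ τ).mul_const _

end MDP

/-! ### Expected regret as a sum over episodes. -/

namespace Learner

variable {n S A l : ℕ} (L : Learner.{u} n S A (l + 1)) (M : MDP n S A)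

/-- The law of an episode, given the seed and the earlier episodes. -/
noncomputable def episodeProb (ω : L.Seed) (t : ℕ) (past : Fin t → Trajectory S A (l + 1))
    (τ : Trajectory S A (l + 1)) : ℝ :=
  M.trajProb (L.play M.reward M.init t past ω) τ

/-- The regret of episode `t` depends only on the episodes before it, so the later ones integrate
out. -/
lemma sum_runProb_mul_nashRegret (ω : L.Seed) (T : ℕ) :
    ∑ ξ : Fin T → Trajectory S A (l + 1), L.runProb M ω ξ * L.nashRegret M ω ξ =
      ∑ t ∈ Finset.range T, ∑ past : Fin t → Trajectory S A (l + 1),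
        seqProb (L.episodeProb M ω) t past *
          (M.optNashWelfare (l + 1) - M.nashWelfare (L.play M.reward M.init t past ω)) := by
  have h : ∀ ξ : Fin T → Trajectory S A (l + 1), L.runProb M ω ξ =
      seqProb (L.episodeProb M ω) T ξ := fun _ => rfl
  simp_rw [h, nashRegret, Finset.mul_sum]
  rw [Finset.sum_comm, ← Fin.sum_univ_eq_sum_range
    (fun t => ∑ past : Fin t → Trajectory S A (l + 1), seqProb (L.episodeProb M ω) t past *
      (M.optNashWelfare (l + 1) - M.nashWelfare (L.play M.reward M.init t past ω)))]
  refine Finset.sum_congr rfl fun t _ => ?_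
  exact sum_seqProb_castLE (fun t past => M.sum_trajProb _) t.isLt.le
    (fun past => M.optNashWelfare (l + 1) - M.nashWelfare (L.play M.reward M.init t past ω))

/-- Needed to interchange the average over instances with the integral over the seed. Boundedness
holds because the run probabilities sum to one. -/
lemma integrable_regret (T : ℕ) {B : ℝ} (hB : ∀ π : Policy S A (l + 1), |M.nashWelfare π| ≤ B) :
    Integrable (fun ω => ∑ ξ : Fin T → Trajectory S A (l + 1),
      L.runProb M ω ξ * L.nashRegret M ω ξ) L.seedLaw := by
  refine Integrable.of_bound (C := T * (|M.optNashWelfare (l + 1)| + B)) ?_ ?_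
  · refine (Finset.measurable_sum _ fun ξ _ => Measurable.mul ?_ ?_).aestronglyMeasurable
    · exact Finset.measurable_prod _ fun t _ =>
        M.measurable_trajProb (L.measurable_play _ _ _ _) _
    · exact Finset.measurable_sum _ fun t _ =>
        (M.measurable_nashWelfare (L.measurable_play _ _ _ _)).const_sub _
  · refine Filter.Eventually.of_forall fun ω => ?_
    have hrun : ∑ ξ : Fin T → Trajectory S A (l + 1), L.runProb M ω ξ = 1 :=
      sum_seqProb (q := L.episodeProb M ω) (fun t past => M.sum_trajProb _) T
    rw [Real.norm_eq_abs, ← one_mul (_ * _ : ℝ), ← hrun, Finset.sum_mul]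
    refine (Finset.abs_sum_le_sum_abs _ _).trans (Finset.sum_le_sum fun ξ _ => ?_)
    have h0 : 0 ≤ L.runProb M ω ξ := Finset.prod_nonneg fun _ _ => M.trajProb_nonneg _ _
    rw [abs_mul, abs_of_nonneg h0]
    refine mul_le_mul_of_nonneg_left ?_ h0
    refine (Finset.abs_sum_le_sum_abs _ _).trans ?_
    refine (Finset.sum_le_card_nsmul _ _ (|M.optNashWelfare (l + 1)| + B) fun t _ => ?_).trans ?_
    · exact (abs_sub _ _).trans (add_le_add_right (hB _) _)
    · simp [mul_add]

end Learner

/-! ### The hard instance and its welfare gap. -/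

section HardInstance

variable (n : ℕ) {k A l : ℕ}

/-- The probability of moving to the good state `0` in the hard instance: the states `0` and `1`
are absorbing, and in every other state `s` the action `θ s` has the advantage `ε`. -/
noncomputable def goodProb (ε : ℝ) (θ : Fin (k + 3) → Option (Fin A)) (s : Fin (k + 3))
    (a : Fin A) : ℝ :=
  if s = 0 then 1 else if s = 1 then 0 else 1 / 2 + if θ s = some a then ε else 0

lemma goodProb_mem {ε : ℝ} (hε : ε ∈ Set.Icc (0 : ℝ) (1 / 4)) (θ : Fin (k + 3) → Option (Fin A))
    (s : Fin (k + 3)) (a : Fin A) : goodProb ε θ s a ∈ Set.Icc (0 : ℝ) 1 := by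
  obtain ⟨h1, h2⟩ := hε
  unfold goodProb
  split_ifs <;> constructor <;> linarith

/-- The uniform distribution on the states other than `0` and `1`. -/
noncomputable def contextLaw (k : ℕ) (s : Fin (k + 3)) : ℝ :=
  if s = 0 then 0 else if s = 1 then 0 else 1 / (k + 1)

lemma contextLaw_nonneg (s : Fin (k + 3)) : 0 ≤ contextLaw k s := by
  unfold contextLaw
  split_ifs <;> positivity

lemma sum_contextLaw (k : ℕ) : ∑ s, contextLaw k s = 1 := by
  have h : ∀ s : Fin (k + 1), contextLaw k s.succ.succ = 1 / (k + 1) := fun s => by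
    have h1 : s.succ.succ ≠ 0 := Fin.succ_ne_zero _
    have h2 : s.succ.succ ≠ 1 := fun h => Fin.succ_ne_zero s (Fin.succ_injective _ h)
    simp [contextLaw, h1, h2]
  rw [Fin.sum_univ_succ, Fin.sum_univ_succ]
  simp_rw [h]
  have h0 : contextLaw k 0 = 0 := by simp [contextLaw]
  have h1 : contextLaw k (Fin.succ 0) = 0 := by simp [contextLaw]
  rw [h0, h1]
  simp
  field_simp

lemma sum_ite_good_bad (x : ℝ) (f : Fin (k + 3) → ℝ) :
    ∑ s' : Fin (k + 3), (if s' = 0 then x else if s' = 1 then 1 - x else 0) * f s' =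
      x * f 0 + (1 - x) * f 1 := by
  have h : ∀ s' : Fin (k + 3), (if s' = 0 then x else if s' = 1 then 1 - x else 0) * f s' =
      (if s' = 0 then x * f 0 else 0) + if s' = 1 then (1 - x) * f 1 else 0 := fun s' => by
    by_cases h0 : s' = 0
    · subst h0; simp
    · by_cases h1 : s' = 1
      · subst h1; simp
      · simp [h0, h1]
  simp_rw [h]
  rw [Finset.sum_add_distrib]
  simp

/-- The hard instance: an episode starts in a uniformly random state other than `0` and `1`, and
its first action decides whether it then stays in the state `0`, which has reward `1`, or in the
state `1`, which has reward `0`. -/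
noncomputable def hardMDP {ε : ℝ} (hε : ε ∈ Set.Icc (0 : ℝ) (1 / 4))
    (θ : Fin (k + 3) → Option (Fin A)) : MDP n (k + 3) A where
  init := ⟨contextLaw k, contextLaw_nonneg, sum_contextLaw k⟩
  trans s a := ⟨fun s' => if s' = 0 then goodProb ε θ s a else
      if s' = 1 then 1 - goodProb ε θ s a else 0, fun s' => by
        have h := goodProb_mem hε θ s a
        dsimp only
        split_ifs
        · exact h.1
        · exact sub_nonneg.2 h.2
        · exact le_rfl, by
        simpa using sum_ite_good_bad (goodProb ε θ s a) (fun _ => 1)⟩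
  reward _ s _ := if s = 1 then 0 else 1
  reward_mem _ s _ := by split_ifs <;> simp

variable {n} {ε : ℝ} (hε : ε ∈ Set.Icc (0 : ℝ) (1 / 4))

lemma hardMDP_support {θ : Fin (k + 3) → Option (Fin A)} {π : Policy (k + 3) A (l + 2)}
    {τ : Trajectory (k + 3) A (l + 2)} (h : (hardMDP n hε θ).trajProb π τ ≠ 0) :
    (τ 0).1 ≠ 0 ∧ (τ 0).1 ≠ 1 ∧ ((τ 1).1 = 0 ∨ (τ 1).1 = 1) ∧
      ∀ h : Fin (l + 1), (τ h.succ).1 = (τ 1).1 := by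
  rw [MDP.trajProb_succ] at h
  have hinit : contextLaw k (τ 0).1 ≠ 0 := left_ne_zero_of_mul (left_ne_zero_of_mul h)
  have htrans : ∀ j : Fin (l + 1), (if (τ j.succ).1 = 0 then goodProb ε θ (τ j.castSucc).1
      (τ j.castSucc).2 else if (τ j.succ).1 = 1 then 1 - goodProb ε θ (τ j.castSucc).1
      (τ j.castSucc).2 else 0) ≠ 0 := fun j =>
    left_ne_zero_of_mul (Finset.prod_ne_zero_iff.1 (right_ne_zero_of_mul h) j (Finset.mem_univ j))
  have h01 : (τ 1).1 = 0 ∨ (τ 1).1 = 1 := by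
    by_contra! hne
    exact htrans 0 ((if_neg hne.1).trans (if_neg hne.2))
  refine ⟨fun h0 => hinit (by simp [contextLaw, h0]), fun h1 => hinit (by simp [contextLaw, h1]),
    h01, fun j => ?_⟩
  induction j using Fin.induction with
  | zero => rfl
  | succ j ih =>
    have hj := htrans j.succ
    rw [← Fin.succ_castSucc, ih] at hj
    rcases h01 with h0 | h1
    · rw [h0]
      by_contra hne
      simp [goodProb, h0, hne] at hj
    · rw [h1]
      by_contra hne
      simp [goodProb, h1, hne] at hj

/-- The initial state always pays `1`; each of the other `l + 1` steps pays `1` exactly when the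
first transition led to the good state. -/
lemma hardMDP_value (θ : Fin (k + 3) → Option (Fin A)) (π : Policy (k + 3) A (l + 2))
    (i : Fin n) : (hardMDP n hε θ).value π i =
      1 + (l + 1) * ∑ s, contextLaw k s * ∑ a, (π 0 s).1 a * goodProb ε θ s a := by
  have h : ∀ τ : Trajectory (k + 3) A (l + 2), (hardMDP n hε θ).trajProb π τ *
      ∑ h, (hardMDP n hε θ).reward i (τ h).1 (τ h).2 = (hardMDP n hε θ).trajProb π τ * 1 +
        (l + 1) * ((hardMDP n hε θ).trajProb π τ * if (τ 1).1 = 0 then 1 else 0) := fun τ => by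
    by_cases hτ : (hardMDP n hε θ).trajProb π τ = 0
    · simp [hτ]
    · obtain ⟨-, h1, h01, hs⟩ := hardMDP_support hε hτ
      rw [Fin.sum_univ_succ]
      simp only [hardMDP, h1, hs, if_false]
      rcases h01 with h0 | h0
      · simp [h0]
        ring
      · simp [h0]
  unfold MDP.value
  simp_rw [h]
  have h2 := (hardMDP n hε θ).sum_trajProb_mul π (fun _ _ s' => if s' = 0 then 1 else 0)
  have h3 : ∀ s a, ∑ s', ((hardMDP n hε θ).trans s a).1 s' * (if s' = 0 then 1 else 0) =
      goodProb ε θ s a := fun s a =>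
    (sum_ite_good_bad (goodProb ε θ s a) (fun s' => if s' = 0 then 1 else 0)).trans (by simp)
  simp_rw [h3] at h2
  rw [Finset.sum_add_distrib, ← Finset.mul_sum, h2]
  simp_rw [mul_one]
  rw [MDP.sum_trajProb]
  rfl

/-- The probability that the first action of an episode is the advantageous one. -/
noncomputable def hitProb (θ : Fin (k + 3) → Fin A) (π : Policy (k + 3) A (l + 2)) : ℝ :=
  ∑ s, contextLaw k s * (π 0 s).1 (θ s)

lemma hitProb_mem (θ : Fin (k + 3) → Fin A) (π : Policy (k + 3) A (l + 2)) :
    hitProb θ π ∈ Set.Icc (0 : ℝ) 1 := by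
  refine ⟨Finset.sum_nonneg fun s _ => mul_nonneg (contextLaw_nonneg s) ((π 0 s).2.1 _), ?_⟩
  rw [← sum_contextLaw k]
  refine Finset.sum_le_sum fun s _ => mul_le_of_le_one_right (contextLaw_nonneg s) ?_
  rw [← (π 0 s).2.2]
  exact Finset.single_le_sum (fun a _ => (π 0 s).2.1 a) (Finset.mem_univ _)

lemma hardMDP_nashWelfare (θ : Fin (k + 3) → Fin A) (π : Policy (k + 3) A (l + 2)) :
    (hardMDP n hε (fun s => some (θ s))).nashWelfare π =
      (1 + (l + 1) * (1 / 2 + ε * hitProb θ π)) ^ n := by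
  have h : ∀ s, contextLaw k s * ∑ a, (π 0 s).1 a * goodProb ε (fun s => some (θ s)) s a =
      contextLaw k s * (1 / 2) + ε * (contextLaw k s * (π 0 s).1 (θ s)) := fun s => by
    by_cases h0 : s = 0
    · simp [contextLaw, h0]
    by_cases h1 : s = 1
    · simp [contextLaw, h1]
    simp only [goodProb, h0, h1, if_false, Option.some.injEq, mul_add]
    rw [Finset.sum_add_distrib, ← Finset.sum_mul, (π 0 s).2.2]
    simp
    ring
  unfold MDP.nashWelfare
  simp_rw [hardMDP_value, h]
  rw [Finset.sum_add_distrib, ← Finset.sum_mul, ← Finset.mul_sum, sum_contextLaw,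
    Finset.prod_const, Finset.card_univ, Fintype.card_fin, one_mul]
  rfl

lemma hardMDP_abs_nashWelfare_le (θ : Fin (k + 3) → Fin A) (π : Policy (k + 3) A (l + 2)) :
    |(hardMDP n hε (fun s => some (θ s))).nashWelfare π| ≤ ((l : ℝ) + 2) ^ n := by
  obtain ⟨h0, h1⟩ := hitProb_mem θ π
  have h2 : 0 ≤ ε * hitProb θ π := mul_nonneg hε.1 h0
  have h3 : ε * hitProb θ π ≤ 1 / 4 := (mul_le_of_le_one_right hε.1 h1).trans hε.2
  have hl : (0 : ℝ) ≤ l := l.cast_nonneg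
  rw [hardMDP_nashWelfare, abs_of_nonneg (by positivity)]
  refine pow_le_pow_left₀ (by positivity) ?_ n
  nlinarith

lemma hardMDP_gap (θ : Fin (k + 3) → Fin A) (π : Policy (k + 3) A (l + 2)) :
    n * (((l : ℝ) + 2) / 2) ^ n * (ε * (1 - hitProb θ π)) ≤
      (hardMDP n hε (fun s => some (θ s))).optNashWelfare (l + 2) -
        (hardMDP n hε (fun s => some (θ s))).nashWelfare π := by
  let πopt : Policy (k + 3) A (l + 2) := fun _ s => ⟨Pi.single (θ s) 1, single_mem_stdSimplex ℝ _⟩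
  have hopt : hitProb θ πopt = 1 := by
    simp [hitProb, πopt, sum_contextLaw]
  have hle : (hardMDP n hε (fun s => some (θ s))).nashWelfare πopt ≤
      (hardMDP n hε (fun s => some (θ s))).optNashWelfare (l + 2) :=
    le_ciSup (f := fun π : Policy (k + 3) A (l + 2) =>
      (hardMDP n hε (fun s => some (θ s))).nashWelfare π) ⟨((l : ℝ) + 2) ^ n, by
        rintro _ ⟨π, rfl⟩
        exact (le_abs_self _).trans (hardMDP_abs_nashWelfare_le hε θ π)⟩ πopt
  refine le_trans ?_ (sub_le_sub_right hle _)
  obtain ⟨h0, h1⟩ := hitProb_mem θ π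
  have hl : (0 : ℝ) ≤ l := l.cast_nonneg
  rw [hardMDP_nashWelfare, hardMDP_nashWelfare, hopt]
  have h2 : 0 ≤ ε * (1 - hitProb θ π) := mul_nonneg hε.1 (sub_nonneg.2 h1)
  have h3 : 0 ≤ ε * hitProb θ π := mul_nonneg hε.1 h0
  -- With `z = (l + 2) / 2`, both values are at least `1 + (l + 1) / 2 ≥ z`, and their difference
  -- `(l + 1) * c` is at least `z * c`.
  refine mul_pow_mul_le_pow_sub_pow (by positivity) ?_ h2 ?_ n <;> nlinarith

/-! ### Change of measure between hard instances. -/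

/-- The likelihood ratio of a transition when the action `a` of the state `s` gets the
advantage `ε`. -/
noncomputable def likelihoodRatio (ε : ℝ) (s : Fin (k + 3)) (a : Fin A) (s₀ : Fin (k + 3))
    (a₀ : Fin A) (s₁ : Fin (k + 3)) : ℝ :=
  if s₀ = s ∧ a₀ = a then (if s₁ = 0 then 1 + 2 * ε else 1 - 2 * ε) else 1

lemma likelihoodRatio_pos (hε : ε ∈ Set.Icc (0 : ℝ) (1 / 4)) (s : Fin (k + 3))
    (a : Fin A) (s₀ : Fin (k + 3)) (a₀ : Fin A) (s₁ : Fin (k + 3)) : 0 < likelihoodRatio ε s a s₀ a₀ s₁ := by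
  obtain ⟨h1, h2⟩ := hε
  unfold likelihoodRatio
  split_ifs <;> linarith

lemma hardMDP_trans_update (θ : Fin (k + 3) → Option (Fin A)) {s : Fin (k + 3)} (hs0 : s ≠ 0)
    (hs1 : s ≠ 1) (a : Fin A) (s₀ : Fin (k + 3)) (a₀ : Fin A) (s₁ : Fin (k + 3)) :
    ((hardMDP n hε (Function.update θ s (some a))).trans s₀ a₀).1 s₁ =
      ((hardMDP n hε (Function.update θ s none)).trans s₀ a₀).1 s₁ *
        likelihoodRatio ε s a s₀ a₀ s₁ := by
  by_cases h : s₀ = s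
  · subst h
    by_cases ha : a₀ = a
    · subst ha
      simp only [hardMDP, goodProb, hs0, hs1, likelihoodRatio]
      split_ifs <;> simp_all <;> ring
    · simp [hardMDP, goodProb, hs0, hs1, likelihoodRatio, ha, Ne.symm ha]
  · simp [hardMDP, goodProb, likelihoodRatio, h]

/-- After the first transition a trajectory of positive probability sits in `0` or `1`, never in
`s`, so all later likelihood ratios equal `1`. -/
lemma hardMDP_trajProb_update (θ : Fin (k + 3) → Option (Fin A)) {s : Fin (k + 3)} (hs0 : s ≠ 0)
    (hs1 : s ≠ 1) (a : Fin A) (π : Policy (k + 3) A (l + 2)) (τ : Trajectory (k + 3) A (l + 2)) :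
    (hardMDP n hε (Function.update θ s (some a))).trajProb π τ =
      (hardMDP n hε (Function.update θ s none)).trajProb π τ *
        likelihoodRatio ε s a (τ 0).1 (τ 0).2 (τ 1).1 := by
  have h : (hardMDP n hε (Function.update θ s (some a))).trajProb π τ =
      (hardMDP n hε (Function.update θ s none)).trajProb π τ *
        ∏ h : Fin (l + 1), likelihoodRatio ε s a (τ h.castSucc).1 (τ h.castSucc).2
          (τ h.succ).1 := by
    rw [MDP.trajProb_succ, MDP.trajProb_succ, mul_assoc _ (∏ _, _), ← Finset.prod_mul_distrib]
    congr 1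
    refine Finset.prod_congr rfl fun j _ => ?_
    rw [hardMDP_trans_update hε θ hs0 hs1]
    ring
  rw [h]
  by_cases hτ : (hardMDP n hε (Function.update θ s none)).trajProb π τ = 0
  · simp [hτ]
  obtain ⟨-, -, h01, hs⟩ := hardMDP_support hε hτ
  congr 1
  rw [Fin.prod_univ_succ]
  refine mul_eq_left₀ (likelihoodRatio_pos hε _ _ _ _ _).ne' |>.2 ?_
  refine Finset.prod_eq_one fun j _ => ?_
  have hne : (τ j.succ.castSucc).1 ≠ s := by
    rw [← Fin.succ_castSucc, hs]
    rcases h01 with h0 | h0 <;> rw [h0]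
    exacts [hs0.symm, hs1.symm]
  exact if_neg fun h => hne h.1

/-- The relative entropy of the law of one episode is proportional to the probability of
playing the perturbed action. -/
lemma sum_trajProb_mul_log_likelihoodRatio (θ : Fin (k + 3) → Option (Fin A)) {s : Fin (k + 3)}
    (hs0 : s ≠ 0) (hs1 : s ≠ 1) (a : Fin A) (π : Policy (k + 3) A (l + 2)) :
    ∑ τ, (hardMDP n hε (Function.update θ s none)).trajProb π τ *
        Real.log (likelihoodRatio ε s a (τ 0).1 (τ 0).2 (τ 1).1) =
      contextLaw k s * ((π 0 s).1 a * (Real.log (1 - 4 * ε ^ 2) / 2)) := by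
  rw [(hardMDP n hε (Function.update θ s none)).sum_trajProb_mul π
    (fun s₀ a₀ s₁ => Real.log (likelihoodRatio ε s a s₀ a₀ s₁))]
  have h : ∀ s₀ a₀, ∑ s₁, ((hardMDP n hε (Function.update θ s none)).trans s₀ a₀).1 s₁ *
      Real.log (likelihoodRatio ε s a s₀ a₀ s₁) =
        if s₀ = s then (if a₀ = a then Real.log (1 - 4 * ε ^ 2) / 2 else 0) else 0 :=
    fun s₀ a₀ => by
      refine (sum_ite_good_bad (goodProb ε (Function.update θ s none) s₀ a₀)
        (fun s₁ => Real.log (likelihoodRatio ε s a s₀ a₀ s₁))).trans ?_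
      by_cases h1 : s₀ = s
      · by_cases h2 : a₀ = a
        · subst h1 h2
          obtain ⟨hε0, hε1⟩ := hε
          simp only [goodProb, likelihoodRatio, hs0, hs1, if_false, and_self, if_true,
            Function.update_self, reduceCtorEq, one_ne_zero]
          rw [show (1 : ℝ) - 4 * ε ^ 2 = (1 + 2 * ε) * (1 - 2 * ε) by ring,
            Real.log_mul (by linarith) (by linarith)]
          ring
        · simp [likelihoodRatio, h2]
      · simp [likelihoodRatio, h1]
  simp_rw [h]
  rw [Finset.sum_eq_single s (fun s₀ _ hne => by simp [hne]) (by simp)]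
  simp only [if_true]
  rw [Finset.sum_eq_single a (fun a₀ _ hne => by simp [hne]) (by simp)]
  simp only [if_true]
  rfl

end HardInstance

/-! ### Missing the secret action, and the averaged regret. -/

section LowerBound

variable {n k A l : ℕ} {ε : ℝ} (hε : ε ∈ Set.Icc (0 : ℝ) (1 / 4))
  (play : (t : ℕ) → (Fin t → Trajectory (k + 3) A (l + 2)) → Policy (k + 3) A (l + 2))

/-- The law of an episode of the hard instance, given the earlier episodes, when the policies are
chosen by `play`. -/
noncomputable def hardEpisodeProb (n : ℕ) (θ : Fin (k + 3) → Option (Fin A)) (t : ℕ)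
    (past : Fin t → Trajectory (k + 3) A (l + 2)) (τ : Trajectory (k + 3) A (l + 2)) : ℝ :=
  (hardMDP n hε θ).trajProb (play t past) τ

lemma hardEpisodeProb_nonneg (θ : Fin (k + 3) → Option (Fin A)) (t : ℕ)
    (past : Fin t → Trajectory (k + 3) A (l + 2)) (τ : Trajectory (k + 3) A (l + 2)) :
    0 ≤ hardEpisodeProb hε play n θ t past τ :=
  (hardMDP n hε θ).trajProb_nonneg _ _

lemma sum_hardEpisodeProb (θ : Fin (k + 3) → Option (Fin A)) (t : ℕ)
    (past : Fin t → Trajectory (k + 3) A (l + 2)) :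
    ∑ τ, hardEpisodeProb hε play n θ t past τ = 1 :=
  (hardMDP n hε θ).sum_trajProb _

lemma neg_log_one_sub_le {x : ℝ} (h0 : 0 ≤ x) (h1 : x ≤ 1 / 2) : -Real.log (1 - x) ≤ 2 * x := by
  have h := Real.one_sub_inv_le_log_of_pos (show 0 < 1 - x by linarith)
  have h2 : (1 - x)⁻¹ ≤ 1 + 2 * x := by
    rw [inv_le_iff_one_le_mul₀ (by linarith)]
    nlinarith
  linarith

/-- Cauchy–Schwarz; it converts the entropy costs of the single actions into their total, which is
controlled because action probabilities sum to one. -/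
lemma sum_sqrt_le_sqrt_card_mul_sum {ι : Type*} [Fintype ι] {x : ι → ℝ} (hx : ∀ i, 0 ≤ x i) :
    ∑ i, √(x i) ≤ √(Fintype.card ι * ∑ i, x i) := by
  refine Real.le_sqrt_of_sq_le ?_
  have h := sq_sum_le_card_mul_sum_sq (s := Finset.univ) (f := fun i => √(x i))
  simpa only [Real.sq_sqrt (hx _), Finset.card_univ] using h

/-- The mean probability of the advantageous action in the state `s` is bounded by its value when
no action of `s` is advantageous, plus an entropy term. -/
lemma sum_seqProb_update_le (θ : Fin (k + 3) → Option (Fin A)) {s : Fin (k + 3)} (hs0 : s ≠ 0)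
    (hs1 : s ≠ 1) (a : Fin A) (t : ℕ) :
    ∑ past, seqProb (hardEpisodeProb hε play n (Function.update θ s (some a))) t past *
        (play t past 0 s).1 a ≤
      ∑ past, seqProb (hardEpisodeProb hε play n (Function.update θ s none)) t past *
        (play t past 0 s).1 a +
      2 * √(contextLaw k s * (-Real.log (1 - 4 * ε ^ 2) / 2) * ∑ u ∈ Finset.range t, ∑ past,
        seqProb (hardEpisodeProb hε play n (Function.update θ s none)) u past *
          (play u past 0 s).1 a) := by
  have h := sum_seqProb_reweight_le
    (hardEpisodeProb_nonneg hε play (Function.update θ s none))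
    (sum_hardEpisodeProb hε play (n := n) (Function.update θ s none))
    (sum_hardEpisodeProb hε play (n := n) (Function.update θ s (some a)))
    (w := fun τ => likelihoodRatio ε s a (τ 0).1 (τ 0).2 (τ 1).1)
    (fun τ => likelihoodRatio_pos hε _ _ _ _ _)
    (fun u past τ => hardMDP_trajProb_update hε θ hs0 hs1 a (play u past) τ) t
    (X := fun past => (play t past 0 s).1 a)
    (fun past => mem_Icc_of_mem_stdSimplex (play t past 0 s).2 a)
  refine h.trans_eq ?_
  congr 3
  rw [Finset.mul_sum, ← Finset.sum_neg_distrib]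
  refine Finset.sum_congr rfl fun u _ => ?_
  rw [Finset.mul_sum, ← Finset.sum_neg_distrib]
  refine Finset.sum_congr rfl fun past _ => ?_
  have h2 := sum_trajProb_mul_log_likelihoodRatio (n := n) hε θ hs0 hs1 a (play u past)
  unfold hardEpisodeProb
  rw [h2]
  ring

lemma sum_sum_seqProb_mul (θ : Fin (k + 3) → Option (Fin A)) (s : Fin (k + 3)) (t : ℕ) :
    ∑ a, ∑ past, seqProb (hardEpisodeProb hε play n θ) t past * (play t past 0 s).1 a = 1 := by
  rw [Finset.sum_comm]
  simp_rw [← Finset.mul_sum, (play _ _ 0 s).2.2, mul_one]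
  exact sum_seqProb (sum_hardEpisodeProb hε play θ) t

/-- If the advantage is small, then in each episode and each state the learner misses the
advantageous action with a mean probability of at least `1 / 4`. -/
lemma card_div_four_le_sum_update {T : ℕ} (hT : 256 * ε ^ 2 * T ≤ (k + 1) * A) (hA : 2 ≤ A)
    (θ : Fin (k + 3) → Option (Fin A)) {s : Fin (k + 3)} (hs0 : s ≠ 0) (hs1 : s ≠ 1) {t : ℕ}
    (ht : t ≤ T) :
    (A : ℝ) / 4 ≤ ∑ a, ∑ past,
      seqProb (hardEpisodeProb hε play n (Function.update θ s (some a))) t past *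
        (1 - (play t past 0 s).1 a) := by
  have hA' : (2 : ℝ) ≤ A := by exact_mod_cast hA
  set κ : ℝ := -Real.log (1 - 4 * ε ^ 2) / 2
  have hε2 : 4 * ε ^ 2 ≤ 1 / 4 := by nlinarith [hε.1, hε.2]
  have hκ0 : 0 ≤ κ := div_nonneg (neg_nonneg.2 (Real.log_nonpos (by linarith)
    (by nlinarith [sq_nonneg ε]))) two_pos.le
  have hκ : κ ≤ 4 * ε ^ 2 := by
    have := neg_log_one_sub_le (x := 4 * ε ^ 2) (by positivity) (by linarith)
    simp only [κ]
    linarith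
  have hρ : contextLaw k s = 1 / (k + 1) := by simp [contextLaw, hs0, hs1]
  have hentropy : ∑ a : Fin A, √(contextLaw k s * κ * ∑ u ∈ Finset.range t, ∑ past,
        seqProb (hardEpisodeProb hε play n (Function.update θ s none)) u past *
          (play u past 0 s).1 a) ≤ A / 8 := by
    refine (sum_sqrt_le_sqrt_card_mul_sum fun a => mul_nonneg (mul_nonneg (contextLaw_nonneg s)
      hκ0) (Finset.sum_nonneg fun u _ => Finset.sum_nonneg fun past _ => mul_nonneg
        (seqProb_nonneg (hardEpisodeProb_nonneg hε play _) _ _) ((play u past 0 s).2.1 a))).trans ?_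
    rw [← Finset.mul_sum, Finset.sum_comm]
    simp_rw [sum_sum_seqProb_mul]
    rw [Finset.sum_const, Finset.card_range, Fintype.card_fin, nsmul_eq_mul, mul_one, hρ]
    refine Real.sqrt_le_iff.2 ⟨by positivity, ?_⟩
    have h1 : κ * t ≤ 4 * ε ^ 2 * T :=
      mul_le_mul hκ (by exact_mod_cast ht) t.cast_nonneg (by positivity)
    have h2 : 1 / ((k : ℝ) + 1) * κ * t ≤ A / 64 := by
      rw [mul_assoc, one_div_mul_eq_div, div_le_iff₀ (by positivity)]
      linarith
    calc (A : ℝ) * (1 / ((k : ℝ) + 1) * κ * t) ≤ A * (A / 64) :=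
          mul_le_mul_of_nonneg_left h2 (by positivity)
      _ = (A / 8) ^ 2 := by ring
  have hsum := Finset.sum_le_sum fun a (_ : a ∈ Finset.univ) =>
    sum_seqProb_update_le (n := n) hε play θ hs0 hs1 a t
  rw [Finset.sum_add_distrib, sum_sum_seqProb_mul, ← Finset.mul_sum] at hsum
  simp_rw [mul_sub, mul_one, Finset.sum_sub_distrib,
    sum_seqProb (sum_hardEpisodeProb hε play (Function.update θ s _)) t]
  simp only [Finset.sum_const, Finset.card_univ, Fintype.card_fin, nsmul_eq_mul, mul_one]
  -- The total hitting probability is at most `1 + 2 * (A / 8)`, which is at most `3 * A / 4` since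
  -- `A ≥ 2`.
  linarith

/-- The bound for a single context needs an average over its secret action; resampling `θ s` inside
the uniform average over `θ` supplies it for every context. -/
lemma card_div_four_le_sum_hitProb {T : ℕ} (hT : 256 * ε ^ 2 * T ≤ (k + 1) * A) (hA : 2 ≤ A)
    {t : ℕ} (ht : t ≤ T) :
    (Fintype.card (Fin (k + 3) → Fin A) : ℝ) / 4 ≤ ∑ θ : Fin (k + 3) → Fin A, ∑ past,
      seqProb (hardEpisodeProb hε play n (fun s => some (θ s))) t past *
        (1 - hitProb θ (play t past)) := by
  set F : Fin (k + 3) → (Fin (k + 3) → Fin A) → ℝ := fun s θ => ∑ past,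
    seqProb (hardEpisodeProb hε play n (fun s => some (θ s))) t past *
      (1 - (play t past 0 s).1 (θ s)) with hF
  have hA' : (0 : ℝ) < A := by exact_mod_cast (by omega : 0 < A)
  have hmiss : ∀ (θ : Fin (k + 3) → Fin A) (π : Policy (k + 3) A (l + 2)),
      1 - hitProb θ π = ∑ s, contextLaw k s * (1 - (π 0 s).1 (θ s)) := fun θ π => by
    simp_rw [mul_sub, mul_one, Finset.sum_sub_distrib, sum_contextLaw]
    rfl
  have hswap : ∑ θ : Fin (k + 3) → Fin A, ∑ past,
      seqProb (hardEpisodeProb hε play n (fun s => some (θ s))) t past *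
        (1 - hitProb θ (play t past)) = ∑ s, contextLaw k s * ∑ θ, F s θ := by
    simp_rw [hmiss, hF, Finset.mul_sum]
    rw [Finset.sum_comm (t := (Finset.univ : Finset (Fin (k + 3) → Fin A)))]
    refine Finset.sum_congr rfl fun θ _ => ?_
    rw [Finset.sum_comm]
    exact Finset.sum_congr rfl fun s _ => Finset.sum_congr rfl fun past _ => by ring
  rw [hswap, ← one_mul (_ / 4 : ℝ), ← sum_contextLaw k, Finset.sum_mul]
  refine Finset.sum_le_sum fun s _ => ?_
  by_cases hs0 : s = 0
  · simp [contextLaw, hs0]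
  by_cases hs1 : s = 1
  · simp [contextLaw, hs1]
  refine mul_le_mul_of_nonneg_left ?_ (contextLaw_nonneg s)
  refine le_of_mul_le_mul_left ?_ hA'
  have h := sum_sum_update s (F s)
  rw [Fintype.card_fin] at h
  rw [← h]
  have h2 : ∀ θ : Fin (k + 3) → Fin A, (A : ℝ) / 4 ≤ ∑ a, F s (Function.update θ s a) :=
    fun θ => by
      refine (card_div_four_le_sum_update (n := n) hε play hT hA (fun s => some (θ s)) hs0 hs1
        ht).trans_eq (Finset.sum_congr rfl fun a _ => ?_)
      have h3 : (fun s' => some (Function.update θ s a s')) =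
          Function.update (fun s => some (θ s)) s (some a) := Function.comp_update some θ s a
      simp only [hF, h3, Function.update_self]
  calc (A : ℝ) * (Fintype.card (Fin (k + 3) → Fin A) / 4)
      = ∑ _θ : Fin (k + 3) → Fin A, (A : ℝ) / 4 := by
        rw [Finset.sum_const, Finset.card_univ, nsmul_eq_mul]
        ring
    _ ≤ _ := Finset.sum_le_sum fun θ _ => h2 θ

/-- The mean regret over the hard instances, for a fixed seed. -/
lemma card_mul_le_sum_regret (L : Learner.{u} n (k + 3) A (l + 2)) (ω : L.Seed) {T : ℕ}
    (hT : 256 * ε ^ 2 * T ≤ (k + 1) * A) (hA : 2 ≤ A) :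
    Fintype.card (Fin (k + 3) → Fin A) *
        (n * (((l : ℝ) + 2) / 2) ^ n * ε * T / 4) ≤
      ∑ θ : Fin (k + 3) → Fin A, ∑ ξ : Fin T → Trajectory (k + 3) A (l + 2),
        L.runProb (hardMDP n hε (fun s => some (θ s))) ω ξ *
          L.nashRegret (hardMDP n hε (fun s => some (θ s))) ω ξ := by
  set M₀ := hardMDP n hε (fun _ : Fin (k + 3) => (none : Option (Fin A)))
  -- Rewards and initial law do not depend on `θ`, so one and the same strategy faces all the hard
  -- instances.
  set play : (t : ℕ) → (Fin t → Trajectory (k + 3) A (l + 2)) → Policy (k + 3) A (l + 2) :=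
    fun t past => L.play M₀.reward M₀.init t past ω
  have h : ∀ θ : Fin (k + 3) → Fin A, n * (((l : ℝ) + 2) / 2) ^ n * ε *
      ∑ t ∈ Finset.range T, ∑ past,
        seqProb (hardEpisodeProb hε play n (fun s => some (θ s))) t past *
          (1 - hitProb θ (play t past)) ≤ ∑ ξ : Fin T → Trajectory (k + 3) A (l + 2),
        L.runProb (hardMDP n hε (fun s => some (θ s))) ω ξ *
          L.nashRegret (hardMDP n hε (fun s => some (θ s))) ω ξ := fun θ => by
    rw [L.sum_runProb_mul_nashRegret, Finset.mul_sum]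
    refine Finset.sum_le_sum fun t _ => ?_
    rw [Finset.mul_sum]
    refine Finset.sum_le_sum fun past _ => ?_
    have h0 := seqProb_nonneg
      (hardEpisodeProb_nonneg (n := n) hε play (fun s => some (θ s))) t past
    change _ ≤ seqProb (hardEpisodeProb hε play n (fun s => some (θ s))) t past * _
    refine Eq.trans_le ?_ (mul_le_mul_of_nonneg_left (hardMDP_gap (n := n) hε θ (play t past)) h0)
    ring
  refine le_trans ?_ (Finset.sum_le_sum fun θ _ => h θ)
  rw [← Finset.mul_sum, Finset.sum_comm]
  have h2 : (T : ℝ) * (Fintype.card (Fin (k + 3) → Fin A) / 4) ≤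
      ∑ t ∈ Finset.range T, ∑ θ : Fin (k + 3) → Fin A, ∑ past,
        seqProb (hardEpisodeProb hε play n (fun s => some (θ s))) t past *
          (1 - hitProb θ (play t past)) := by
    calc (T : ℝ) * (Fintype.card (Fin (k + 3) → Fin A) / 4)
        = ∑ _t ∈ Finset.range T, (Fintype.card (Fin (k + 3) → Fin A) : ℝ) / 4 := by simp
      _ ≤ _ := Finset.sum_le_sum fun t ht =>
        card_div_four_le_sum_hitProb hε play hT hA (Finset.mem_range.1 ht).le
  have h3 : 0 ≤ n * (((l : ℝ) + 2) / 2) ^ n * ε := mul_nonneg (by positivity) hε.1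
  refine Eq.trans_le ?_ (mul_le_mul_of_nonneg_left h2 h3)
  ring

lemma exists_hardMDP_regret (hε : ε ∈ Set.Icc (0 : ℝ) (1 / 4))
    (L : Learner.{u} n (k + 3) A (l + 2)) {T : ℕ}
    (hT : 256 * ε ^ 2 * T ≤ (k + 1) * A) (hA : 2 ≤ A) :
    ∃ M : MDP n (k + 3) A,
      n * (((l : ℝ) + 2) / 2) ^ n * ε * T / 4 ≤ L.expectedNashRegret M T := by
  have : NeZero A := ⟨by omega⟩
  set B : ℝ := n * (((l : ℝ) + 2) / 2) ^ n * ε * T / 4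
  have hint : ∀ θ : Fin (k + 3) → Fin A, Integrable
      (fun ω => ∑ ξ : Fin T → Trajectory (k + 3) A (l + 2),
        L.runProb (hardMDP n hε (fun s => some (θ s))) ω ξ *
          L.nashRegret (hardMDP n hε (fun s => some (θ s))) ω ξ) L.seedLaw := fun θ =>
    L.integrable_regret _ T (hardMDP_abs_nashWelfare_le hε θ)
  have h : ∑ _θ : Fin (k + 3) → Fin A, B ≤ ∑ θ : Fin (k + 3) → Fin A,
      L.expectedNashRegret (hardMDP n hε (fun s => some (θ s))) T := by
    unfold Learner.expectedNashRegret
    rw [← integral_finsetSum _ fun θ _ => hint θ]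
    have h1 : ∑ _θ : Fin (k + 3) → Fin A, B = ∫ _ω : L.Seed,
        (Fintype.card (Fin (k + 3) → Fin A) * B : ℝ) ∂L.seedLaw := by
      simp
    rw [h1]
    exact integral_mono (integrable_const _) (integrable_finsetSum _ fun θ _ => hint θ)
      fun ω => card_mul_le_sum_regret hε L ω hT hA
  obtain ⟨θ, -, hθ⟩ := Finset.exists_le_of_sum_le Finset.univ_nonempty h
  exact ⟨_, hθ⟩

end LowerBound

/-! ### Choice of the constants. -/

theorem mainTheorem6 :
    ∃ C c₁ c₂ : ℝ, 0 < C ∧ 0 < c₁ ∧ 0 < c₂ ∧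
      ∀ n S A H T : ℕ, 1 ≤ n → 3 ≤ S → 2 ≤ A → S * A ≤ T →
        c₁ * Real.log (H : ℝ) ≤ (T : ℝ) → c₂ * Real.log (S : ℝ) ≤ (H : ℝ) →
        ∀ L : Learner.{u} n S A H, ∃ M : MDP n S A,
          C * (n : ℝ) * ((H : ℝ) / 2) ^ n * Real.sqrt ((S : ℝ) * (A : ℝ) * (T : ℝ)) ≤
            L.expectedNashRegret M T := by
  -- `1 / 128` is `1 / 4`, from the miss probability, times `1 / 32`, from `hsqrt`. With `c₂ = 1`,
  -- the bound `log S > 1` for `S ≥ 3` forces `H ≥ 2`, so there is a transition to learn from.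
  refine ⟨1 / 128, 1, 1, by norm_num, one_pos, one_pos, ?_⟩
  intro n S A H T _ hS hA hT _ hH L
  have hH2 : 2 ≤ H := by
    have h3 : (1 : ℝ) < Real.log S := by
      rw [Real.lt_log_iff_exp_lt (by positivity)]
      have : (3 : ℝ) ≤ S := by exact_mod_cast hS
      linarith [Real.exp_one_lt_d9]
    have : (1 : ℝ) < H := by linarith
    exact_mod_cast this
  obtain ⟨k, rfl⟩ := Nat.exists_eq_add_of_le' hS
  obtain ⟨l, rfl⟩ := Nat.exists_eq_add_of_le' hH2
  have hTpos : (0 : ℝ) < T := by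
    exact_mod_cast lt_of_lt_of_le (Nat.mul_pos (by omega) (by omega)) hT
  have hT' : ((k : ℝ) + 3) * A ≤ T := by exact_mod_cast hT
  -- The largest advantage allowed by `256 * ε ^ 2 * T ≤ (k + 1) * A`, where `k + 1 = S - 2` counts
  -- the contexts; `T ≥ S * A` keeps it at most `1 / 16`.
  set ε : ℝ := √((k + 1) * A / T) / 16 with hεdef
  have hε2 : ε ^ 2 = (k + 1) * A / T / 256 := by
    rw [hεdef, div_pow, Real.sq_sqrt (by positivity)]
    norm_num
  have hε : ε ∈ Set.Icc (0 : ℝ) (1 / 4) := by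
    refine ⟨by positivity, ?_⟩
    have h1 : √((k + 1) * A / T) ≤ 1 := by
      rw [Real.sqrt_le_one, div_le_one hTpos]
      have : (0 : ℝ) ≤ A := A.cast_nonneg
      nlinarith
    rw [hεdef]
    linarith
  have hsmall : 256 * ε ^ 2 * T ≤ (k + 1) * A := by
    rw [hε2]
    exact le_of_eq (by field_simp)
  obtain ⟨M, hM⟩ := exists_hardMDP_regret hε L hsmall hA
  refine ⟨M, le_trans ?_ hM⟩
  -- Passing from `k + 1` contexts back to `S = k + 3` states costs a factor `4` under the root, as
  -- `k + 3 ≤ 4 * (k + 1)`.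
  have hsqrt : √(((k : ℝ) + 3) * A * T) ≤ 32 * (ε * T) := by
    refine Real.sqrt_le_iff.2 ⟨mul_nonneg (by norm_num) (mul_nonneg hε.1 hTpos.le), ?_⟩
    have h1 : (32 * (ε * T)) ^ 2 = 4 * ((k + 1) * A * T) := by
      rw [mul_pow, mul_pow, hε2]
      field_simp
      norm_num
    rw [h1]
    have h2 : (0 : ℝ) ≤ A * T := by positivity
    have hk : (0 : ℝ) ≤ k := k.cast_nonneg
    nlinarith [mul_nonneg hk h2]
  push_cast
  have h0 : 0 ≤ n * (((l : ℝ) + 2) / 2) ^ n := by positivity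
  refine (mul_le_mul_of_nonneg_left hsqrt (by positivity)).trans_eq ?_
  ring
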